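/- Call a finite set of points in the Euclidean plane in general position if no three of its points are collinear and no four of its points are concyclic. Let $n$ be a positive integer, let $S$ be a set of $2n+1$ points in general position in the plane, and let $a<b$ be nonnegative integers with $a+b=2n-2$. Call a circle $(a,b)$-splitting if it passes through exactly three points of $S$, has exactly $a$ points of $S$ in its interior, and has the remaining $b$ points of $S$ in its exterior. Then there are exactly $2(a+1)(b+1)$ circles that are either $(a,b)$-splitting or $(b,a)$-splitting. -/

import Mathlib

/-- The Euclidean plane. -/
abbrev Plane : Type := EuclideanSpace ℝ (Fin 2)

/-- A finite set of points of the plane is in general position if no three of its points are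
collinear and no four of its points are concyclic. -/
def InGeneralPosition (S : Finset Plane) : Prop :=
  (∀ T : Finset Plane, T ⊆ S → T.card = 3 → ¬ Collinear ℝ (T : Set Plane)) ∧
  (∀ T : Finset Plane, T ⊆ S → T.card = 4 → ¬ EuclideanGeometry.Concyclic (T : Set Plane))

/-- The circle `C` (of positive radius) is `(a, b)`-splitting for `S`: it passes through exactly
three points of `S`, has exactly `a` points of `S` in its interior and exactly `b` points of `S`
in its exterior. -/
def IsSplitting (S : Finset Plane) (a b : ℕ) (C : EuclideanGeometry.Sphere Plane) : Prop :=
  0 < C.radius ∧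
  {p : Plane | p ∈ S ∧ dist p C.center = C.radius}.ncard = 3 ∧
  {p : Plane | p ∈ S ∧ dist p C.center < C.radius}.ncard = a ∧
  {p : Plane | p ∈ S ∧ C.radius < dist p C.center}.ncard = b

/-! Let N_j be the number of circles through three points of S with j points inside, plus the number
with j points outside. The sum of N_j * C(j, m) counts pairs (U, circle) in which U is an
(m+3)-subset of S, the circle passes through three points of U, and the other points of U are all
inside or all outside (`sum_choose_card_related`).

For fixed U this count depends only on m. Choose a linear height that is injective on S and assign
each circle to the middle one, p, of its three points. Inversion at p turns the circles through p
into lines, and the circle is extreme exactly when all other points lie on one side of its line.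
Among the segments from a point above the axis to a point below it, exactly one has the rest on its
left and exactly one has the rest on its right (`card_leftmost_crossings`,
`card_rightmost_crossings`). So each of the m+1 points of U that are neither highest nor lowest
contributes 2 (`InGeneralPosition.card_extremePairs`).

All binomial moments of N are therefore known. They agree with those of 2(j+1)(|S|-2-j), and the
moments determine the sequence (`card_filter_card_related`). The theorem is the case j = a. -/

/-! ### Binomial moments -/

open Finset in
/-- Binomial moments determine a finitely supported sequence. -/
theorem eq_of_sum_mul_choose_eq (f g : ℕ → ℕ) (n : ℕ)
    (H : ∀ m, ∑ j ∈ range n, f j * j.choose m = ∑ j ∈ range n, g j * j.choose m) :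
    ∀ j < n, f j = g j := by
  induction n with
  | zero => intro j hj; omega
  | succ n ih =>
    -- The n-th moment sees only the last term.
    have vanish (u : ℕ → ℕ) : ∑ j ∈ range n, u j * j.choose n = 0 :=
      sum_eq_zero fun j hj => by simp [Nat.choose_eq_zero_of_lt (mem_range.1 hj)]
    have top : f n = g n := by
      have := H n
      simpa [sum_range_succ, vanish] using this
    intro j hj
    rcases Nat.lt_succ_iff_lt_or_eq.1 hj with hj | rfl
    · refine ih (fun m => ?_) j hj
      have := H m
      rw [sum_range_succ, sum_range_succ, top] at this
      omega
    · exact top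

open Finset in
/-- The moments of the sequence `2 * (j + 1) * (k - j)`. -/
theorem sum_succ_mul_sub_mul_choose (k m : ℕ) :
    ∑ j ∈ range k, 2 * (j + 1) * (k - j) * j.choose m = 2 * (m + 1) * (k + 2).choose (m + 3) := by
  have linear (k : ℕ) : ∑ j ∈ range k, (j + 1) * j.choose m = (m + 1) * (k + 1).choose (m + 2) := by
    induction k with
    | zero => simp [Nat.choose_eq_zero_of_lt]
    | succ k ih =>
      rw [sum_range_succ, ih, Nat.add_one_mul_choose_eq k m, Nat.choose_succ_succ (k + 1) (m + 1)]
      ring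
  induction k with
  | zero => simp [Nat.choose_eq_zero_of_lt]
  | succ k ih =>
    -- Raising k by one raises each factor k - j by one, and the new term j = k has factor 1.
    have step : ∑ j ∈ range (k + 1), 2 * (j + 1) * (k + 1 - j) * j.choose m
        = ∑ j ∈ range k, 2 * (j + 1) * (k - j) * j.choose m
          + 2 * ∑ j ∈ range (k + 1), (j + 1) * j.choose m := by
      rw [mul_sum, sum_range_succ, sum_range_succ (fun j => 2 * ((j + 1) * j.choose m)),
        ← add_assoc, ← sum_add_distrib]
      congr 1
      · refine sum_congr rfl fun j hj => ?_
        rw [Nat.sub_add_comm (mem_range.1 hj).le]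
        ring
      · rw [Nat.add_sub_cancel_left]; ring
    rw [step, ih, linear, Nat.choose_succ_succ (k + 2) (m + 2)]
    ring

/-! ### Double counting of extreme triples -/

section SortedTriples

open Finset
open scoped Classical

variable {ι : Type*} (h : ι → ℝ) (I : ι → ι → ι → ι → Prop)

/-- Triples `(p, q, r)` of elements of `U` with `q` above `p` and `r` below `p`. -/
noncomputable def sortedTriples (U : Finset ι) : Finset (ι × ι × ι) :=
  {t ∈ U ×ˢ U ×ˢ U | h t.2.2 < h t.1 ∧ h t.1 < h t.2.1}

/-- The elements `s` of `S` outside the triple `t` with `I t s`. -/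
noncomputable def related (S : Finset ι) (t : ι × ι × ι) : Finset ι :=
  {s ∈ S | s ≠ t.1 ∧ s ≠ t.2.1 ∧ s ≠ t.2.2 ∧ I t.1 t.2.1 t.2.2 s}

/-- The sorted triples of `U` which are related to all other elements of `U`. -/
noncomputable def extremeTriples (U : Finset ι) : Finset (ι × ι × ι) :=
  {t ∈ sortedTriples h U |
    ∀ s ∈ U, s ≠ t.1 → s ≠ t.2.1 → s ≠ t.2.2 → I t.1 t.2.1 t.2.2 s}

/-- The pairs completing `p` to an extreme triple of `U`. -/
noncomputable def extremePairs (U : Finset ι) (p : ι) : Finset (ι × ι) :=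
  {x ∈ U ×ˢ U | h p < h x.1 ∧ h x.2 < h p ∧
    ∀ s ∈ U, s ≠ p → s ≠ x.1 → s ≠ x.2 → I p x.1 x.2 s}

/-- Adjoining the triple to an m-set of related elements gives an (m+3)-set in which the triple is
extreme; removing it is the inverse. -/
theorem choose_card_related (S : Finset ι) (m : ℕ) {t : ι × ι × ι} (ht : t ∈ sortedTriples h S) :
    (#(related I S t)).choose m = #{U ∈ powersetCard (m + 3) S | t ∈ extremeTriples h I U} := by
  obtain ⟨p, q, r⟩ := t
  simp only [sortedTriples, mem_filter, mem_product] at ht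
  obtain ⟨⟨hp, hq, hr⟩, hrp, hpq⟩ := ht
  have npq : p ≠ q := by rintro rfl; exact lt_irrefl _ hpq
  have npr : p ≠ r := by rintro rfl; exact lt_irrefl _ hrp
  have nqr : q ≠ r := by rintro rfl; exact lt_asymm hrp hpq
  have c3 : #({p, q, r} : Finset ι) = 3 := card_eq_three.2 ⟨p, q, r, npq, npr, nqr, rfl⟩
  rw [← card_powersetCard]
  refine card_nbij' (fun W => W ∪ {p, q, r}) (fun U => U \ {p, q, r}) ?_ ?_ ?_ ?_
  · intro W hW
    simp only [mem_coe, mem_powersetCard] at hW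
    obtain ⟨hW, rfl⟩ := hW
    have hW' : ∀ s ∈ W, s ∈ S ∧ s ≠ p ∧ s ≠ q ∧ s ≠ r ∧ I p q r s := fun s hs => by
      simpa [related] using hW hs
    have hd : Disjoint W {p, q, r} := by
      rw [disjoint_left]
      intro s hs
      have := hW' s hs
      simp [this]
    simp only [coe_filter, mem_powersetCard, Set.mem_ofPred_eq]
    refine ⟨⟨?_, by rw [card_union_of_disjoint hd, c3]⟩, ?_⟩
    · intro s hs
      simp only [mem_union, mem_insert, mem_singleton] at hs
      rcases hs with hs | rfl | rfl | rfl
      · exact (hW' s hs).1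
      all_goals assumption
    · simp only [extremeTriples, sortedTriples, mem_filter, mem_product]
      refine ⟨⟨⟨by simp, by simp, by simp⟩, hrp, hpq⟩, fun s hs h1 h2 h3 => ?_⟩
      simp only [mem_union, mem_insert, mem_singleton, h1, h2, h3, or_false] at hs
      exact (hW' s hs).2.2.2.2
  · intro U hU
    simp only [coe_filter, mem_powersetCard, Set.mem_ofPred_eq, extremeTriples, sortedTriples,
      mem_filter, mem_product] at hU
    obtain ⟨⟨hUS, hc⟩, ⟨⟨hp', hq', hr'⟩, -⟩, hI⟩ := hU
    have hsub : ({p, q, r} : Finset ι) ⊆ U := by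
      simp [insert_subset_iff, hp', hq', hr']
    simp only [mem_coe, mem_powersetCard]
    refine ⟨fun s hs => ?_, by rw [card_sdiff_of_subset hsub, hc, c3]; rfl⟩
    simp only [mem_sdiff, mem_insert, mem_singleton, not_or] at hs
    simp only [related, mem_filter]
    exact ⟨hUS hs.1, hs.2.1, hs.2.2.1, hs.2.2.2, hI s hs.1 hs.2.1 hs.2.2.1 hs.2.2.2⟩
  · intro W hW
    simp only [mem_coe, mem_powersetCard] at hW
    have hd : Disjoint W {p, q, r} := by
      rw [disjoint_left]
      intro s hs
      have := hW.1 hs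
      simp only [related, mem_filter] at this
      simp [this]
    exact union_sdiff_cancel_right hd
  · intro U hU
    simp only [coe_filter, Set.mem_ofPred_eq, extremeTriples, sortedTriples,
      mem_filter, mem_product] at hU
    obtain ⟨-, ⟨⟨hp', hq', hr'⟩, -⟩, -⟩ := hU
    exact sdiff_union_of_subset (by simp [insert_subset_iff, hp', hq', hr'])

theorem sum_choose_card_related (S : Finset ι) (m : ℕ) :
    ∑ t ∈ sortedTriples h S, (#(related I S t)).choose m =
      ∑ U ∈ powersetCard (m + 3) S, #(extremeTriples h I U) := by
  rw [sum_congr rfl fun t ht => choose_card_related h I S m ht]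
  have := sum_card_bipartiteAbove_eq_sum_card_bipartiteBelow
    (s := sortedTriples h S) (t := powersetCard (m + 3) S)
    (fun t U => t ∈ extremeTriples h I U)
  simp only [bipartiteAbove, bipartiteBelow] at this
  rw [this]
  refine sum_congr rfl fun U hU => ?_
  congr 1
  ext t
  simp only [mem_filter, and_iff_right_iff_imp]
  intro ht
  have hUS := (mem_powersetCard.1 hU).1
  simp only [extremeTriples, sortedTriples, mem_filter, mem_product] at ht ⊢
  exact ⟨⟨hUS ht.1.1.1, hUS ht.1.1.2.1, hUS ht.1.1.2.2⟩, ht.1.2⟩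

theorem card_extremeTriples (U : Finset ι) :
    #(extremeTriples h I U) = ∑ p ∈ U, #(extremePairs h I U p) := by
  rw [card_eq_sum_card_fiberwise (f := Prod.fst) (t := U)]
  · refine sum_congr rfl fun p hp => ?_
    refine card_nbij' Prod.snd (Prod.mk p) ?_ ?_ ?_ ?_
    · rintro ⟨p', q, r⟩ ht
      simp only [coe_filter, Set.mem_ofPred_eq, extremeTriples, sortedTriples, mem_filter,
        mem_product] at ht
      obtain ⟨ht, rfl⟩ := ht
      simp only [extremePairs, coe_filter, Set.mem_ofPred_eq, mem_product]
      tauto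
    · rintro ⟨q, r⟩ ht
      simp only [extremePairs, coe_filter, Set.mem_ofPred_eq, mem_product] at ht
      simp only [coe_filter, Set.mem_ofPred_eq, extremeTriples, sortedTriples, mem_filter,
        mem_product]
      tauto
    · rintro ⟨p', q, r⟩ ht
      simp only [coe_filter, Set.mem_ofPred_eq] at ht
      simp [ht.2]
    · intro x _
      rfl
  · intro t ht
    simp only [extremeTriples, sortedTriples, coe_filter, mem_filter, mem_product,
      Set.mem_ofPred_eq] at ht
    exact ht.1.1.1

theorem card_filter_exists_lt_and_gt {U : Finset ι} (hU : Set.InjOn h U) (hc : 2 ≤ #U) :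
    #{p ∈ U | (∃ q ∈ U, h p < h q) ∧ ∃ r ∈ U, h r < h p} = #U - 2 := by
  have hne : U.Nonempty := card_pos.1 (by omega)
  obtain ⟨a, ha, hamax⟩ := exists_max_image U h hne
  obtain ⟨b, hb, hbmin⟩ := exists_min_image U h hne
  have hab : a ≠ b := by
    rintro rfl
    obtain ⟨x, hx, y, hy, hxy⟩ := one_lt_card.1 (show 1 < #U by omega)
    exact hxy (hU hx hy (le_antisymm ((hamax x hx).trans (hbmin y hy))
      ((hamax y hy).trans (hbmin x hx))))
  have : ({p ∈ U | (∃ q ∈ U, h p < h q) ∧ ∃ r ∈ U, h r < h p} : Finset ι) =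
      (U.erase a).erase b := by
    ext p
    simp only [mem_filter, mem_erase]
    constructor
    · rintro ⟨hp, ⟨q, hq, hpq⟩, r, hr, hrp⟩
      refine ⟨?_, ?_, hp⟩
      · rintro rfl; exact absurd hrp (not_lt.2 (hbmin r hr))
      · rintro rfl; exact absurd hpq (not_lt.2 (hamax q hq))
    · rintro ⟨hpb, hpa, hp⟩
      exact ⟨hp, ⟨a, ha, lt_of_le_of_ne (hamax p hp) fun e => hpa (hU hp ha e)⟩,
        ⟨b, hb, lt_of_le_of_ne (hbmin p hp) fun e => hpb (hU hp hb e.symm)⟩⟩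
  rw [this, card_erase_of_mem (mem_erase.2 ⟨hab.symm, hb⟩), card_erase_of_mem ha]
  omega

/-- The highest and lowest elements are never the middle of a triple; each of the others contributes
2. -/
theorem sum_card_extremePairs {O : ι → ι → ι → ι → Prop} {U : Finset ι} (hU : Set.InjOn h U)
    (hc : 2 ≤ #U)
    (H : ∀ p ∈ U, (∃ q ∈ U, h p < h q) → (∃ r ∈ U, h r < h p) →
      #(extremePairs h I U p) + #(extremePairs h O U p) = 2) :
    #(extremeTriples h I U) + #(extremeTriples h O U) = 2 * (#U - 2) := by
  have empty_of (J : ι → ι → ι → ι → Prop) (p : ι)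
      (hp : ¬ ((∃ q ∈ U, h p < h q) ∧ ∃ r ∈ U, h r < h p)) : #(extremePairs h J U p) = 0 := by
    rw [card_eq_zero, extremePairs, filter_eq_empty_iff]
    rintro ⟨q, r⟩ hx ⟨h1, h2, -⟩
    exact hp ⟨⟨q, (mem_product.1 hx).1, h1⟩, r, (mem_product.1 hx).2, h2⟩
  rw [card_extremeTriples, card_extremeTriples, ← sum_add_distrib,
    ← card_filter_exists_lt_and_gt h hU hc, mul_comm, card_filter, sum_mul]
  refine sum_congr rfl fun p hp => ?_
  split_ifs with hh
  · rw [H p hp hh.1 hh.2, one_mul]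
  · simp [empty_of I p hh, empty_of O p hh]

/-- If in every subset of `S` every element that is neither highest nor lowest is the middle of
exactly two extreme triples, then the numbers of triples with `j` related elements are
determined. -/
theorem card_filter_card_related {O : ι → ι → ι → ι → Prop} {S : Finset ι} (hS : Set.InjOn h S)
    (H : ∀ U ⊆ S, ∀ p ∈ U, (∃ q ∈ U, h p < h q) → (∃ r ∈ U, h r < h p) →
      #(extremePairs h I U p) + #(extremePairs h O U p) = 2)
    {j k : ℕ} (hk : #S = k + 2) (hj : j < k) :
    #{t ∈ sortedTriples h S | #(related I S t) = j} +
      #{t ∈ sortedTriples h S | #(related O S t) = j} = 2 * (j + 1) * (k - j) := by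
  -- Related elements avoid the triple, so there are at most k - 1 of them and `range k` misses no
  -- triple.
  have small (J : ι → ι → ι → ι → Prop) : ∀ t ∈ sortedTriples h S, #(related J S t) < k := by
    rintro ⟨p, q, r⟩ ht
    simp only [sortedTriples, mem_filter, mem_product] at ht
    obtain ⟨⟨hp, hq, hr⟩, hrp, hpq⟩ := ht
    have npq : p ≠ q := by rintro rfl; exact lt_irrefl _ hpq
    have npr : p ≠ r := by rintro rfl; exact lt_irrefl _ hrp
    have nqr : q ≠ r := by rintro rfl; exact lt_asymm hrp hpq
    have c3 : #({p, q, r} : Finset ι) = 3 := card_eq_three.2 ⟨p, q, r, npq, npr, nqr, rfl⟩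
    have hsub : ({p, q, r} : Finset ι) ⊆ S := by simp [insert_subset_iff, hp, hq, hr]
    have : related J S (p, q, r) ⊆ S \ {p, q, r} := by
      intro s hs
      simp only [related, mem_filter] at hs
      simp [hs]
    have := card_le_card this
    have := card_le_card hsub
    rw [card_sdiff_of_subset hsub] at *
    omega
  have moment (J : ι → ι → ι → ι → Prop) (m : ℕ) :
      ∑ i ∈ range k, #{t ∈ sortedTriples h S | #(related J S t) = i} * i.choose m =
        ∑ U ∈ powersetCard (m + 3) S, #(extremeTriples h J U) := by
    rw [← sum_choose_card_related, ← sum_fiberwise_of_maps_to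
      (fun t ht => mem_range.2 (small J t ht))]
    refine sum_congr rfl fun i _ => ?_
    rw [sum_congr rfl fun t ht => by rw [(mem_filter.1 ht).2], sum_const, smul_eq_mul]
  refine eq_of_sum_mul_choose_eq
    (fun j => #{t ∈ sortedTriples h S | #(related I S t) = j} +
      #{t ∈ sortedTriples h S | #(related O S t) = j})
    (fun j => 2 * (j + 1) * (k - j)) k (fun m => ?_) j hj
  simp only [add_mul _ _ (Nat.choose _ _)]
  rw [sum_add_distrib, moment, moment, ← sum_add_distrib, sum_succ_mul_sub_mul_choose, ← hk]
  have : ∀ U ∈ powersetCard (m + 3) S,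
      #(extremeTriples h I U) + #(extremeTriples h O U) = 2 * (m + 1) := fun U hU => by
    obtain ⟨hUS, hc⟩ := mem_powersetCard.1 hU
    rw [sum_card_extremePairs h I (hS.mono (by exact_mod_cast hUS)) (by omega)
      (H U hUS), hc]
    rfl
  rw [sum_congr rfl this, sum_const, card_powersetCard, smul_eq_mul, mul_comm]

end SortedTriples

/-! ### Extreme segments across an axis -/

section Crossing

open Finset
open scoped Classical

variable {ι : Type*} (X Y : ι → ℝ)

/-- Positive if `(X s, Y s)` lies to the right of the line through the points of `q` and `r`,
when `q` is above `r`. -/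
def sideTest (q r s : ι) : ℝ :=
  (Y q - Y r) * X s - (X r * Y q - X q * Y r) - (X q - X r) * Y s

/-- The abscissa at which the line through the points of `q` and `r` meets the horizontal axis. -/
noncomputable def crossing (q r : ι) : ℝ := (X r * Y q - X q * Y r) / (Y q - Y r)

/-- The inverse slope of the line through the points of `q` and `r`. -/
noncomputable def invSlope (q r : ι) : ℝ := (X q - X r) / (Y q - Y r)

variable {X Y}

theorem sideTest_eq {q r : ι} (hqr : Y r < Y q) (s : ι) :
    sideTest X Y q r s = (Y q - Y r) * (X s - crossing X Y q r - invSlope X Y q r * Y s) := by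
  have : Y q - Y r ≠ 0 := (sub_pos.2 hqr).ne'
  unfold sideTest crossing invSlope
  field_simp

theorem abscissa_left_eq {q r : ι} (hqr : Y r < Y q) :
    X q = crossing X Y q r + invSlope X Y q r * Y q := by
  have : Y q - Y r ≠ 0 := (sub_pos.2 hqr).ne'
  unfold crossing invSlope
  field_simp
  ring

theorem abscissa_right_eq {q r : ι} (hqr : Y r < Y q) :
    X r = crossing X Y q r + invSlope X Y q r * Y r := by
  have : Y q - Y r ≠ 0 := (sub_pos.2 hqr).ne'
  unfold crossing invSlope
  field_simp
  ring

theorem sideTest_neg (q r s : ι) :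
    sideTest (fun i => -X i) Y q r s = -sideTest X Y q r s := by
  unfold sideTest; ring

/-- Among the segments joining a point above the axis to a point below it, exactly one has all
other points on its left. -/
theorem card_leftmost_crossings {V : Finset ι} (hY : ∀ s ∈ V, Y s ≠ 0) (hpos : ∃ q ∈ V, 0 < Y q)
    (hneg : ∃ r ∈ V, Y r < 0)
    (hD : ∀ q ∈ V, ∀ r ∈ V, ∀ s ∈ V, 0 < Y q → Y r < 0 → s ≠ q → s ≠ r →
      sideTest X Y q r s ≠ 0) :
    #{x ∈ V ×ˢ V | (0 < Y x.1 ∧ Y x.2 < 0) ∧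
      ∀ s ∈ V, s ≠ x.1 → s ≠ x.2 → sideTest X Y x.1 x.2 s < 0} = 1 := by
  obtain ⟨q₀, hq₀, hq₀'⟩ := hpos
  obtain ⟨r₀, hr₀, hr₀'⟩ := hneg
  obtain ⟨⟨q, r⟩, hx, hmax⟩ := exists_max_image
    ({x ∈ V ×ˢ V | 0 < Y x.1 ∧ Y x.2 < 0}) (fun x => crossing X Y x.1 x.2)
    ⟨(q₀, r₀), by simp [*]⟩
  simp only [mem_filter, mem_product] at hx hmax
  obtain ⟨⟨hq, hr⟩, hYq, hYr⟩ := hx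
  have hqr : Y r < Y q := hYr.trans hYq
  have left_of_max : ∀ s ∈ V, s ≠ q → s ≠ r → sideTest X Y q r s < 0 := by
    intro s hs hsq hsr
    refine lt_of_le_of_ne ?_ (hD q hq r hr s hs hYq hYr hsq hsr)
    rw [sideTest_eq hqr]
    refine mul_nonpos_of_nonneg_of_nonpos (sub_pos.2 hqr).le ?_
    -- If s were to the right of the line, putting s in place of the endpoint on its side of the
    -- axis would move the crossing to the right, against maximality.
    by_contra! hlt
    rcases (hY s hs).lt_or_gt with h | h
    · have hqs : Y s < Y q := h.trans hYq
      have hle := hmax (q, s) ⟨⟨hq, hs⟩, hYq, h⟩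
      dsimp only at hle
      have e1 := abscissa_left_eq (X := X) hqs
      have e2 := abscissa_right_eq (X := X) hqs
      have e3 := abscissa_left_eq (X := X) hqr
      have k1 : (invSlope X Y q s - invSlope X Y q r) * Y q =
          crossing X Y q r - crossing X Y q s := by linear_combination e3 - e1
      have k2 : 0 < crossing X Y q s - crossing X Y q r +
          (invSlope X Y q s - invSlope X Y q r) * Y s := by linear_combination hlt + e2
      have k3 : 0 ≤ invSlope X Y q s - invSlope X Y q r := by
        by_contra! hh
        nlinarith
      nlinarith
    · have hqs : Y r < Y s := hYr.trans h
      have hle := hmax (s, r) ⟨⟨hs, hr⟩, h, hYr⟩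
      dsimp only at hle
      have e1 := abscissa_right_eq (X := X) hqs
      have e2 := abscissa_left_eq (X := X) hqs
      have e3 := abscissa_right_eq (X := X) hqr
      have k1 : (invSlope X Y s r - invSlope X Y q r) * Y r =
          crossing X Y q r - crossing X Y s r := by linear_combination e3 - e1
      have k2 : 0 < crossing X Y s r - crossing X Y q r +
          (invSlope X Y s r - invSlope X Y q r) * Y s := by linear_combination hlt + e2
      have k3 : invSlope X Y s r - invSlope X Y q r ≤ 0 := by
        by_contra! hh
        nlinarith
      nlinarith
  -- Uniqueness: two such segments would each cross strictly to the right of the other.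
  have crossing_lt : ∀ q₁ ∈ V, ∀ r₁ ∈ V, ∀ q₂ ∈ V, ∀ r₂ ∈ V, 0 < Y q₁ → Y r₁ < 0 → 0 < Y q₂ →
      Y r₂ < 0 → (∀ s ∈ V, s ≠ q₁ → s ≠ r₁ → sideTest X Y q₁ r₁ s < 0) →
      (q₂, r₂) ≠ (q₁, r₁) → crossing X Y q₂ r₂ < crossing X Y q₁ r₁ := by
    intro q₁ hq₁ r₁ hr₁ q₂ hq₂ r₂ hr₂ Yq₁ Yr₁ Yq₂ Yr₂ hall hne
    have l1 : Y r₁ < Y q₁ := Yr₁.trans Yq₁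
    have l2 : Y r₂ < Y q₂ := Yr₂.trans Yq₂
    have strict : ∀ s ∈ V, s ≠ q₁ → s ≠ r₁ →
        X s < crossing X Y q₁ r₁ + invSlope X Y q₁ r₁ * Y s := by
      intro s hs h1 h2
      have := hall s hs h1 h2
      rw [sideTest_eq l1] at this
      have := neg_of_mul_neg_right this (sub_pos.2 l1).le
      linarith
    have weak : ∀ s ∈ V, X s ≤ crossing X Y q₁ r₁ + invSlope X Y q₁ r₁ * Y s := by
      intro s hs
      by_cases h1 : s = q₁
      · rw [h1]; exact (abscissa_left_eq l1).le
      by_cases h2 : s = r₁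
      · rw [h2]; exact (abscissa_right_eq l1).le
      exact (strict s hs h1 h2).le
    have e1 := abscissa_left_eq (X := X) l2
    have e2 := abscissa_right_eq (X := X) l2
    have n1 : q₂ ≠ r₁ := by rintro rfl; exact lt_asymm Yq₂ Yr₁
    have n2 : r₂ ≠ q₁ := by rintro rfl; exact lt_asymm Yq₁ Yr₂
    have w1 := weak q₂ hq₂
    have w2 := weak r₂ hr₂
    -- The second crossing is a convex combination of the endpoints of its segment, both weakly left
    -- of the first line and at least one strictly.
    have combo : (crossing X Y q₂ r₂ - crossing X Y q₁ r₁) * (Y q₂ - Y r₂) =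
        (X r₂ - crossing X Y q₁ r₁ - invSlope X Y q₁ r₁ * Y r₂) * Y q₂ +
        (X q₂ - crossing X Y q₁ r₁ - invSlope X Y q₁ r₁ * Y q₂) * (-Y r₂) := by
      linear_combination (-Y r₂) * (-e1) + Y q₂ * (-e2)
    have : (crossing X Y q₂ r₂ - crossing X Y q₁ r₁) * (Y q₂ - Y r₂) < 0 := by
      rw [combo]
      by_cases h1 : q₂ = q₁
      · have h2 : r₂ ≠ r₁ := fun h2 => hne (by rw [h1, h2])
        have := strict r₂ hr₂ n2 h2
        exact add_neg_of_neg_of_nonpos (mul_neg_of_neg_of_pos (by linarith) Yq₂)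
          (mul_nonpos_of_nonpos_of_nonneg (by linarith) (by linarith))
      · have := strict q₂ hq₂ h1 n1
        exact add_neg_of_nonpos_of_neg
          (mul_nonpos_of_nonpos_of_nonneg (by linarith) Yq₂.le)
          (mul_neg_of_neg_of_pos (by linarith) (by linarith))
    exact sub_neg.1 (neg_of_mul_neg_left this (sub_pos.2 l2).le)
  rw [card_eq_one]
  refine ⟨(q, r), ?_⟩
  ext ⟨q', r'⟩
  simp only [mem_filter, mem_product, mem_singleton]
  constructor
  · rintro ⟨⟨hq', hr'⟩, ⟨hYq', hYr'⟩, hall⟩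
    by_contra hne
    have h1 := crossing_lt q hq r hr q' hq' r' hr' hYq hYr hYq' hYr' left_of_max hne
    have h2 := crossing_lt q' hq' r' hr' q hq r hr hYq' hYr' hYq hYr hall (Ne.symm hne)
    exact lt_asymm h1 h2
  · intro e
    obtain ⟨rfl, rfl⟩ := Prod.mk.inj e
    exact ⟨⟨hq, hr⟩, ⟨hYq, hYr⟩, left_of_max⟩

/-- The mirror image under X ↦ -X. -/
theorem card_rightmost_crossings {V : Finset ι} (hY : ∀ s ∈ V, Y s ≠ 0) (hpos : ∃ q ∈ V, 0 < Y q)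
    (hneg : ∃ r ∈ V, Y r < 0)
    (hD : ∀ q ∈ V, ∀ r ∈ V, ∀ s ∈ V, 0 < Y q → Y r < 0 → s ≠ q → s ≠ r →
      sideTest X Y q r s ≠ 0) :
    #{x ∈ V ×ˢ V | (0 < Y x.1 ∧ Y x.2 < 0) ∧
      ∀ s ∈ V, s ≠ x.1 → s ≠ x.2 → 0 < sideTest X Y x.1 x.2 s} = 1 := by
  have := card_leftmost_crossings (X := fun i => -X i) hY hpos hneg (by
    intro q hq r hr s hs h1 h2 h3 h4
    rw [sideTest_neg]
    exact neg_ne_zero.2 (hD q hq r hr s hs h1 h2 h3 h4))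
  simpa only [sideTest_neg, neg_lt_zero] using this

end Crossing

/-! ### Circles in the plane and inversion -/

section Geometry

theorem dist_sq_eq (x y : Plane) : dist x y ^ 2 = (x 0 - y 0) ^ 2 + (x 1 - y 1) ^ 2 := by
  rw [EuclideanSpace.dist_eq, Real.sq_sqrt (by positivity)]
  simp [Fin.sum_univ_two, Real.dist_eq, sq_abs]

theorem dist_eq_dist_iff (x y c : Plane) : dist x c = dist y c ↔
    (x 0 - c 0) ^ 2 + (x 1 - c 1) ^ 2 = (y 0 - c 0) ^ 2 + (y 1 - c 1) ^ 2 := by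
  rw [← dist_sq_eq, ← dist_sq_eq, sq_eq_sq₀ dist_nonneg dist_nonneg]

theorem plane_ext {x y : Plane} (h0 : x 0 = y 0) (h1 : x 1 = y 1) : x = y := by
  ext i
  fin_cases i
  · exact h0
  · exact h1

/-- Twice the signed area of the triangle `pqr`. -/
def signedArea (p q r : Plane) : ℝ :=
  (q 0 - p 0) * (r 1 - p 1) - (q 1 - p 1) * (r 0 - p 0)

theorem signedArea_ne_zero {p q r : Plane} (hpq : p ≠ q)
    (h : ¬ Collinear ℝ ({p, q, r} : Set Plane)) : signedArea p q r ≠ 0 := by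
  intro h0
  apply h
  have hd : (q 0 - p 0) ^ 2 + (q 1 - p 1) ^ 2 ≠ 0 := by
    rw [← dist_sq_eq]
    exact pow_ne_zero 2 (dist_ne_zero.2 hpq.symm)
  rw [collinear_iff_of_mem (p₀ := p) (by simp)]
  refine ⟨q - p, ?_⟩
  unfold signedArea at h0
  intro x hx
  simp only [Set.mem_insert_iff, Set.mem_singleton_iff] at hx
  rcases hx with rfl | rfl | rfl
  · exact ⟨0, by simp⟩
  · exact ⟨1, by simp⟩
  · refine ⟨((x 0 - p 0) * (q 0 - p 0) + (x 1 - p 1) * (q 1 - p 1)) /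
      ((q 0 - p 0) ^ 2 + (q 1 - p 1) ^ 2), plane_ext ?_ ?_⟩
    · simp only [vadd_eq_add, PiLp.add_apply, PiLp.smul_apply, PiLp.sub_apply, smul_eq_mul]
      field_simp
      linear_combination (-(q 1 - p 1)) * h0
    · simp only [vadd_eq_add, PiLp.add_apply, PiLp.smul_apply, PiLp.sub_apply, smul_eq_mul]
      field_simp
      linear_combination (q 0 - p 0) * h0

theorem exists_equidistant {p q r : Plane} (h : signedArea p q r ≠ 0) :
    ∃ c : Plane, dist q c = dist p c ∧ dist r c = dist p c := by
  let A := (q 0 - p 0) ^ 2 + (q 1 - p 1) ^ 2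
  let B := (r 0 - p 0) ^ 2 + (r 1 - p 1) ^ 2
  -- Cramer's rule for 2(q - p)·(c - p) = A and 2(r - p)·(c - p) = B.
  refine ⟨!₂[p 0 + (A * (r 1 - p 1) - B * (q 1 - p 1)) / (2 * signedArea p q r),
    p 1 + (B * (q 0 - p 0) - A * (r 0 - p 0)) / (2 * signedArea p q r)], ?_, ?_⟩ <;>
  · rw [dist_eq_dist_iff]
    simp only [A, B, Matrix.cons_val_zero, Matrix.cons_val_one,
      Matrix.cons_val_fin_one]
    field_simp
    unfold signedArea
    ring

theorem equidistant_unique {p q r c c' : Plane} (h : signedArea p q r ≠ 0)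
    (h1 : dist q c = dist p c) (h2 : dist r c = dist p c)
    (h1' : dist q c' = dist p c') (h2' : dist r c' = dist p c') : c = c' := by
  rw [dist_eq_dist_iff] at *
  refine plane_ext (mul_left_cancel₀ h ?_) (mul_left_cancel₀ h ?_) <;> unfold signedArea
  · linear_combination (-(r 1 - p 1) / 2) * (h1 - h1') + ((q 1 - p 1) / 2) * (h2 - h2')
  · linear_combination ((r 0 - p 0) / 2) * (h1 - h1') - ((q 0 - p 0) / 2) * (h2 - h2')

/-- A point equidistant from `p`, `q` and `r`, if there is one. -/
noncomputable def circleCenter (p q r : Plane) : Plane :=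
  Classical.epsilon fun c => dist q c = dist p c ∧ dist r c = dist p c

theorem dist_circleCenter {p q r : Plane} (h : signedArea p q r ≠ 0) :
    dist q (circleCenter p q r) = dist p (circleCenter p q r) ∧
      dist r (circleCenter p q r) = dist p (circleCenter p q r) :=
  Classical.epsilon_spec (exists_equidistant h)

/-- `s` lies inside the circle through `p`, `q` and `r`. -/
def InCircle (p q r s : Plane) : Prop := dist s (circleCenter p q r) < dist p (circleCenter p q r)

/-- `s` lies outside the circle through `p`, `q` and `r`. -/
def OutCircle (p q r s : Plane) : Prop := dist p (circleCenter p q r) < dist s (circleCenter p q r)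

/-- A linear coordinate on the plane, depending on the parameter `t`. -/
def height (t : ℝ) (s : Plane) : ℝ := s 0 + t * s 1

theorem exists_height_injOn (S : Finset Plane) : ∃ t : ℝ, Set.InjOn (height t) S := by
  classical
  -- The finitely many t that give two points the same height. Pairs with equal second coordinates
  -- only exclude t = 0, harmlessly.
  obtain ⟨t, ht⟩ := Infinite.exists_notMem_finset
    ((S ×ˢ S).image fun x => -((x.1 0 - x.2 0) / (x.1 1 - x.2 1)))
  refine ⟨t, fun x hx y hy hxy => ?_⟩
  unfold height at hxy
  by_cases h1 : x 1 = y 1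
  · exact plane_ext (by rw [h1] at hxy; linarith) h1
  · exfalso
    apply ht
    rw [Finset.mem_image]
    refine ⟨(x, y), Finset.mem_product.2 ⟨hx, hy⟩, ?_⟩
    have := sub_ne_zero.2 h1
    dsimp only
    field_simp
    linear_combination -hxy

/-- The first coordinate of the image of `s` under the inversion centred at `p`. -/
noncomputable def invX (p s : Plane) : ℝ := (s 1 - p 1) / dist s p ^ 2

/-- The second coordinate of that image, along `height t`. -/
noncomputable def invY (t : ℝ) (p s : Plane) : ℝ := (height t s - height t p) / dist s p ^ 2

theorem invY_pos {t : ℝ} {p s : Plane} (h : s ≠ p) :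
    0 < invY t p s ↔ height t p < height t s := by
  have : 0 < dist s p ^ 2 := pow_pos (dist_pos.2 h) 2
  rw [invY, div_pos_iff_of_pos_right this, sub_pos]

theorem invY_neg {t : ℝ} {p s : Plane} (h : s ≠ p) :
    invY t p s < 0 ↔ height t s < height t p := by
  have : 0 < dist s p ^ 2 := pow_pos (dist_pos.2 h) 2
  rw [invY, div_lt_iff₀ this, zero_mul, sub_neg]

/-- The power of s with respect to a circle through p is, up to the positive factor `dist s p ^ 2`,
affine in the inverted coordinates: the circle becomes a line. -/
theorem dist_sq_sub_dist_sq (t : ℝ) (p c s : Plane) (h : s ≠ p) :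
    dist s c ^ 2 - dist p c ^ 2 = dist s p ^ 2 *
      (1 - 2 * ((c 1 - p 1) - t * (c 0 - p 0)) * invX p s - 2 * (c 0 - p 0) * invY t p s) := by
  have hd : dist s p ^ 2 ≠ 0 := pow_ne_zero 2 (dist_ne_zero.2 h)
  have : dist s c ^ 2 - dist p c ^ 2 = dist s p ^ 2 -
      2 * ((c 1 - p 1) - t * (c 0 - p 0)) * (s 1 - p 1) -
      2 * (c 0 - p 0) * (height t s - height t p) := by
    rw [dist_sq_eq, dist_sq_eq, dist_sq_eq]
    unfold height
    ring
  rw [this, invX, invY]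
  generalize dist s p ^ 2 = d at hd
  field_simp

/-- That affine function vanishes at q and r, hence is a multiple of `sideTest`. -/
theorem exists_sideTest_eq {t : ℝ} {p q r c : Plane} (hq : height t p < height t q)
    (hr : height t r < height t p) (h1 : dist q c = dist p c) (h2 : dist r c = dist p c) :
    ∃ α : ℝ, α ≠ 0 ∧ ∀ s, s ≠ p →
      dist s c ^ 2 - dist p c ^ 2 = α * sideTest (invX p) (invY t p) q r s * dist s p ^ 2 := by
  have nq : q ≠ p := by rintro rfl; exact lt_irrefl _ hq
  have nr : r ≠ p := by rintro rfl; exact lt_irrefl _ hr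
  have Yq := (invY_pos nq).2 hq
  have Yr := (invY_neg nr).2 hr
  have on_line : ∀ s, s ≠ p → dist s c = dist p c →
      1 - 2 * ((c 1 - p 1) - t * (c 0 - p 0)) * invX p s - 2 * (c 0 - p 0) * invY t p s = 0 := by
    intro s hs hd
    have h := dist_sq_sub_dist_sq t p c s hs
    rw [hd, sub_self] at h
    exact (mul_eq_zero.1 h.symm).resolve_left (pow_ne_zero 2 (dist_ne_zero.2 hs))
  have eq := on_line q nq h1
  have er := on_line r nr h2
  set a := 2 * ((c 1 - p 1) - t * (c 0 - p 0))
  set b := 2 * (c 0 - p 0)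
  -- Otherwise the line would be horizontal, yet it contains points at two different heights.
  have ha : a ≠ 0 := by
    intro ha
    rw [ha] at eq er
    have hb : b = 0 := by
      have : b * (invY t p q - invY t p r) = 0 := by linear_combination er - eq
      exact (mul_eq_zero.1 this).resolve_right (by linarith)
    rw [hb] at eq
    norm_num at eq
  have hd : invY t p q - invY t p r ≠ 0 := by linarith
  -- The ratio of the coefficients of `invX p s`.
  refine ⟨-a / (invY t p q - invY t p r), div_ne_zero (neg_ne_zero.2 ha) hd, fun s hs => ?_⟩
  rw [dist_sq_sub_dist_sq t p c s hs, mul_comm]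
  congr 1
  field_simp
  unfold sideTest
  linear_combination (invY t p s - invY t p r) * eq + (invY t p q - invY t p s) * er

open Finset in
theorem InGeneralPosition.signedArea_ne_zero {S : Finset Plane} (hS : InGeneralPosition S)
    {p q r : Plane} (hp : p ∈ S) (hq : q ∈ S) (hr : r ∈ S) (hpq : p ≠ q) (hpr : p ≠ r)
    (hqr : q ≠ r) : signedArea p q r ≠ 0 := by
  classical
  refine _root_.signedArea_ne_zero hpq ?_
  have := hS.1 {p, q, r} (by simp [insert_subset_iff, *])
    (card_eq_three.2 ⟨p, q, r, hpq, hpr, hqr, rfl⟩)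
  simpa using this

open Finset in
theorem InGeneralPosition.dist_ne {S : Finset Plane} (hS : InGeneralPosition S)
    {p q r s c : Plane} (hp : p ∈ S) (hq : q ∈ S) (hr : r ∈ S) (hs : s ∈ S) (hpq : p ≠ q)
    (hpr : p ≠ r) (hqr : q ≠ r) (hsp : s ≠ p) (hsq : s ≠ q) (hsr : s ≠ r)
    (h1 : dist q c = dist p c) (h2 : dist r c = dist p c) : dist s c ≠ dist p c := by
  classical
  intro h3
  refine hS.2 {s, p, q, r} (by simp [insert_subset_iff, *]) ?_ ⟨⟨c, dist p c, ?_⟩, ?_⟩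
  · rw [card_insert_of_notMem (by simp [*]), card_eq_three.2 ⟨p, q, r, hpq, hpr, hqr, rfl⟩]
  · simp [h1, h2, h3]
  -- `Concyclic` also demands coplanarity.
  · exact coplanar_of_finrank_eq_two _ (by simp)

open Finset in
open scoped Classical in
theorem InGeneralPosition.card_extremePairs {S : Finset Plane} (hS : InGeneralPosition S) {t : ℝ}
    (ht : Set.InjOn (height t) S) {U : Finset Plane} (hU : U ⊆ S) {p : Plane} (hp : p ∈ U)
    (hpos : ∃ q ∈ U, height t p < height t q) (hneg : ∃ r ∈ U, height t r < height t p) :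
    #(extremePairs (height t) InCircle U p) + #(extremePairs (height t) OutCircle U p) = 2 := by
  set P : Finset (Plane × Plane) := {x ∈ U.erase p ×ˢ U.erase p |
    0 < invY t p x.1 ∧ invY t p x.2 < 0} with hP
  have key : ∀ q r, q ∈ U → r ∈ U → q ≠ p → r ≠ p → 0 < invY t p q → invY t p r < 0 →
      ∃ α : ℝ, α ≠ 0 ∧ ∀ s ∈ U, s ≠ p →
        (InCircle p q r s ↔ α * sideTest (invX p) (invY t p) q r s < 0) ∧
        (OutCircle p q r s ↔ 0 < α * sideTest (invX p) (invY t p) q r s) ∧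
        (s ≠ q → s ≠ r → sideTest (invX p) (invY t p) q r s ≠ 0) := by
    intro q r hq hr nq nr Yq Yr
    have nqr : q ≠ r := by rintro rfl; exact lt_asymm Yq Yr
    obtain ⟨h1, h2⟩ := dist_circleCenter
      (hS.signedArea_ne_zero (hU hp) (hU hq) (hU hr) nq.symm nr.symm nqr)
    obtain ⟨α, hα, hs⟩ := exists_sideTest_eq ((invY_pos nq).1 Yq) ((invY_neg nr).1 Yr) h1 h2
    refine ⟨α, hα, fun s hsU hsp => ?_⟩
    have hd : 0 < dist s p ^ 2 := pow_pos (dist_pos.2 hsp) 2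
    have e := hs s hsp
    refine ⟨?_, ?_, fun hsq hsr h0 => ?_⟩
    · rw [InCircle, ← sq_lt_sq₀ dist_nonneg dist_nonneg, ← sub_neg, e, ← neg_pos,
        ← neg_mul, mul_pos_iff_of_pos_right hd, neg_pos]
    · rw [OutCircle, ← sq_lt_sq₀ dist_nonneg dist_nonneg, ← sub_pos, e, mul_pos_iff_of_pos_right hd]
    · rw [h0, mul_zero, zero_mul, sub_eq_zero, sq_eq_sq₀ dist_nonneg dist_nonneg] at e
      exact hS.dist_ne (hU hp) (hU hq) (hU hr) (hU hsU) nq.symm nr.symm nqr hsp hsq hsr h1 h2 e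
  have extreme_eq (J : Plane → Plane → Plane → Plane → Prop) :
      extremePairs (height t) J U p =
        {x ∈ P | ∀ s ∈ U.erase p, s ≠ x.1 → s ≠ x.2 → J p x.1 x.2 s} := by
    ext ⟨q, r⟩
    simp only [extremePairs, hP, mem_filter, mem_product, mem_erase]
    constructor
    · rintro ⟨⟨hq, hr⟩, h1, h2, h3⟩
      have nq : q ≠ p := by rintro rfl; exact lt_irrefl _ h1
      have nr : r ≠ p := by rintro rfl; exact lt_irrefl _ h2
      exact ⟨⟨⟨⟨nq, hq⟩, nr, hr⟩, (invY_pos nq).2 h1, (invY_neg nr).2 h2⟩,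
        fun s hs => h3 s hs.2 hs.1⟩
    · rintro ⟨⟨⟨⟨nq, hq⟩, nr, hr⟩, h1, h2⟩, h3⟩
      exact ⟨⟨hq, hr⟩, (invY_pos nq).1 h1, (invY_neg nr).1 h2, fun s hs hsp => h3 s ⟨hsp, hs⟩⟩
  have hY : ∀ s ∈ U.erase p, invY t p s ≠ 0 := by
    intro s hs
    obtain ⟨hsp, hs⟩ := mem_erase.1 hs
    refine div_ne_zero (sub_ne_zero.2 fun e => hsp (ht (hU hs) (hU hp) e))
      (pow_ne_zero 2 (dist_ne_zero.2 hsp))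
  have hpos' : ∃ q ∈ U.erase p, 0 < invY t p q := by
    obtain ⟨q, hq, h⟩ := hpos
    have nq : q ≠ p := by rintro rfl; exact lt_irrefl _ h
    exact ⟨q, mem_erase.2 ⟨nq, hq⟩, (invY_pos nq).2 h⟩
  have hneg' : ∃ r ∈ U.erase p, invY t p r < 0 := by
    obtain ⟨r, hr, h⟩ := hneg
    have nr : r ≠ p := by rintro rfl; exact lt_irrefl _ h
    exact ⟨r, mem_erase.2 ⟨nr, hr⟩, (invY_neg nr).2 h⟩
  have hD : ∀ q ∈ U.erase p, ∀ r ∈ U.erase p, ∀ s ∈ U.erase p, 0 < invY t p q → invY t p r < 0 →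
      s ≠ q → s ≠ r → sideTest (invX p) (invY t p) q r s ≠ 0 := by
    intro q hq r hr s hs Yq Yr
    obtain ⟨α, -, h⟩ := key q r (mem_erase.1 hq).2 (mem_erase.1 hr).2 (mem_erase.1 hq).1
      (mem_erase.1 hr).1 Yq Yr
    exact (h s (mem_erase.1 hs).2 (mem_erase.1 hs).1).2.2
  have left := card_leftmost_crossings hY hpos' hneg' hD
  have right := card_rightmost_crossings hY hpos' hneg' hD
  rw [← filter_filter, ← hP] at left right
  refine Eq.trans ?_ (congrArg₂ (fun m n : ℕ => m + n) left right)
  rw [extreme_eq, extreme_eq, card_filter, card_filter, card_filter, card_filter, ← sum_add_distrib,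
    ← sum_add_distrib]
  refine sum_congr rfl ?_
  rintro ⟨q, r⟩ hx
  simp only [hP, mem_filter, mem_product, mem_erase] at hx
  obtain ⟨⟨⟨nq, hq⟩, nr, hr⟩, Yq, Yr⟩ := hx
  obtain ⟨α, hα, h⟩ := key q r hq hr nq nr Yq Yr
  -- The sign of α, which varies with the pair, decides whether inside means left or right. So only
  -- the sum of the two counts can be compared, pair by pair.
  have swap {A B C D : Prop} {_ : Decidable A} {_ : Decidable B} {_ : Decidable C}
      {_ : Decidable D}
      (e : (A ↔ C) ∧ (B ↔ D) ∨ (A ↔ D) ∧ (B ↔ C)) :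
      (if A then 1 else 0) + (if B then 1 else 0) =
        (if C then 1 else 0) + (if D then (1 : ℕ) else 0) := by
    rcases e with ⟨e1, e2⟩ | ⟨e1, e2⟩ <;> simp only [e1, e2]
    exact add_comm _ _
  apply swap
  rcases hα.lt_or_gt with hα | hα
  · right
    constructor <;> refine forall₂_congr fun s hs => ?_ <;>
      obtain ⟨hsp, hs⟩ := mem_erase.1 hs
    · rw [(h s hs hsp).1, mul_neg_iff]; simp [hα, hα.not_gt]
    · rw [(h s hs hsp).2.1, mul_pos_iff]; simp [hα, hα.not_gt]
  · left
    constructor <;> refine forall₂_congr fun s hs => ?_ <;>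
      obtain ⟨hsp, hs⟩ := mem_erase.1 hs
    · rw [(h s hs hsp).1, mul_neg_iff]; simp [hα, hα.not_gt]
    · rw [(h s hs hsp).2.1, mul_pos_iff]; simp [hα, hα.not_gt]

end Geometry

/-! ### From circles to sorted triples -/

section Counting

open Finset
open scoped Classical

theorem exists_sorted_triple {ι : Type*} {h : ι → ℝ} {T : Finset ι} (hT : Set.InjOn h T)
    (hc : #T = 3) : ∃ p q r, T = {p, q, r} ∧ h r < h p ∧ h p < h q := by
  obtain ⟨x, y, z, hxy, hxz, hyz, rfl⟩ := card_eq_three.1 hc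
  have nxy : h x ≠ h y := fun e => hxy (hT (by simp) (by simp) e)
  have nxz : h x ≠ h z := fun e => hxz (hT (by simp) (by simp) e)
  have nyz : h y ≠ h z := fun e => hyz (hT (by simp) (by simp) e)
  rcases nxy.lt_or_gt with h1 | h1 <;> rcases nxz.lt_or_gt with h2 | h2 <;>
    rcases nyz.lt_or_gt with h3 | h3
  · exact ⟨y, z, x, by ext; simp; tauto, h1, h3⟩
  · exact ⟨z, y, x, by ext; simp; tauto, h2, h3⟩
  · linarith
  · exact ⟨x, y, z, rfl, h2, h1⟩
  · exact ⟨x, z, y, by ext; simp; tauto, h1, h2⟩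
  · linarith
  · exact ⟨z, x, y, by ext; simp; tauto, h3, h2⟩
  · exact ⟨y, x, z, by ext; simp; tauto, h3, h1⟩

theorem sorted_triple_unique {ι : Type*} [DecidableEq ι] {h : ι → ℝ} {p q r p' q' r' : ι}
    (e : ({p, q, r} : Finset ι) = {p', q', r'}) (h1 : h r < h p) (h2 : h p < h q)
    (h1' : h r' < h p') (h2' : h p' < h q') : (p, q, r) = (p', q', r') := by
  have mp : p ∈ ({p', q', r'} : Finset ι) := e ▸ by simp
  have mq : q ∈ ({p', q', r'} : Finset ι) := e ▸ by simp
  have mr : r ∈ ({p', q', r'} : Finset ι) := e ▸ by simp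
  simp only [mem_insert, mem_singleton] at mp mq mr
  rcases mp with rfl | rfl | rfl <;> rcases mq with rfl | rfl | rfl <;>
    rcases mr with rfl | rfl | rfl <;> first | rfl | (exfalso; linarith)

/-- The circle through the points of a triple. -/
noncomputable def tripleCircle (x : Plane × Plane × Plane) : EuclideanGeometry.Sphere Plane :=
  ⟨circleCenter x.1 x.2.1 x.2.2, dist x.1 (circleCenter x.1 x.2.1 x.2.2)⟩

variable {S : Finset Plane} {t : ℝ}

theorem mem_sortedTriples_height {p q r : Plane} : (p, q, r) ∈ sortedTriples (height t) S ↔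
    (p ∈ S ∧ q ∈ S ∧ r ∈ S) ∧ height t r < height t p ∧ height t p < height t q := by
  simp [sortedTriples]

theorem ne_of_sorted {p q r : Plane} (h1 : height t r < height t p)
    (h2 : height t p < height t q) : p ≠ q ∧ p ≠ r ∧ q ≠ r :=
  ⟨by rintro rfl; exact lt_irrefl _ h2, by rintro rfl; exact lt_irrefl _ h1,
    by rintro rfl; exact lt_asymm h1 h2⟩

namespace InGeneralPosition

theorem dist_circleCenter_of_sorted (hS : InGeneralPosition S) {p q r : Plane}
    (hx : (p, q, r) ∈ sortedTriples (height t) S) :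
    dist q (circleCenter p q r) = dist p (circleCenter p q r) ∧
      dist r (circleCenter p q r) = dist p (circleCenter p q r) := by
  obtain ⟨⟨hp, hq, hr⟩, h1, h2⟩ := mem_sortedTriples_height.1 hx
  obtain ⟨npq, npr, nqr⟩ := ne_of_sorted h1 h2
  exact dist_circleCenter (hS.signedArea_ne_zero hp hq hr npq npr nqr)

theorem points_on_tripleCircle (hS : InGeneralPosition S) {p q r : Plane}
    (hx : (p, q, r) ∈ sortedTriples (height t) S) :
    {s | s ∈ S ∧ dist s (tripleCircle (p, q, r)).center = (tripleCircle (p, q, r)).radius} =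
      (({p, q, r} : Finset Plane) : Set Plane) := by
  obtain ⟨e1, e2⟩ := hS.dist_circleCenter_of_sorted hx
  obtain ⟨⟨hp, hq, hr⟩, h1, h2⟩ := mem_sortedTriples_height.1 hx
  obtain ⟨npq, npr, nqr⟩ := ne_of_sorted h1 h2
  ext s
  simp only [tripleCircle, Set.mem_ofPred_eq, coe_insert, coe_singleton, Set.mem_insert_iff,
    Set.mem_singleton_iff]
  constructor
  · rintro ⟨hs, e⟩
    by_contra! hne
    exact hS.dist_ne hp hq hr hs npq npr nqr hne.1 hne.2.1 hne.2.2 e1 e2 e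
  · rintro (rfl | rfl | rfl)
    · exact ⟨hp, rfl⟩
    · exact ⟨hq, e1⟩
    · exact ⟨hr, e2⟩

theorem points_in_tripleCircle (hS : InGeneralPosition S) {p q r : Plane}
    (hx : (p, q, r) ∈ sortedTriples (height t) S) :
    {s | s ∈ S ∧ dist s (tripleCircle (p, q, r)).center < (tripleCircle (p, q, r)).radius} =
      (related InCircle S (p, q, r) : Set Plane) := by
  obtain ⟨e1, e2⟩ := hS.dist_circleCenter_of_sorted hx
  ext s
  simp only [tripleCircle, Set.mem_ofPred_eq, related, mem_coe, mem_filter]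
  refine ⟨fun ⟨hs, h⟩ => ⟨hs, ?_, ?_, ?_, h⟩, fun ⟨hs, _, _, _, h⟩ => ⟨hs, h⟩⟩ <;> rintro rfl
  · exact h.ne rfl
  · exact h.ne e1
  · exact h.ne e2

theorem points_out_tripleCircle (hS : InGeneralPosition S) {p q r : Plane}
    (hx : (p, q, r) ∈ sortedTriples (height t) S) :
    {s | s ∈ S ∧ (tripleCircle (p, q, r)).radius < dist s (tripleCircle (p, q, r)).center} =
      (related OutCircle S (p, q, r) : Set Plane) := by
  obtain ⟨e1, e2⟩ := hS.dist_circleCenter_of_sorted hx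
  ext s
  simp only [tripleCircle, Set.mem_ofPred_eq, related, mem_coe, mem_filter]
  refine ⟨fun ⟨hs, h⟩ => ⟨hs, ?_, ?_, ?_, h⟩, fun ⟨hs, _, _, _, h⟩ => ⟨hs, h⟩⟩ <;> rintro rfl
  · exact h.ne rfl
  · exact h.ne e1.symm
  · exact h.ne e2.symm

theorem isSplitting_tripleCircle (hS : InGeneralPosition S) {x : Plane × Plane × Plane}
    (hx : x ∈ sortedTriples (height t) S) (a b : ℕ) :
    IsSplitting S a b (tripleCircle x) ↔
      #(related InCircle S x) = a ∧ #(related OutCircle S x) = b := by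
  obtain ⟨p, q, r⟩ := x
  obtain ⟨⟨hp, hq, hr⟩, h1, h2⟩ := mem_sortedTriples_height.1 hx
  obtain ⟨npq, npr, nqr⟩ := ne_of_sorted h1 h2
  obtain ⟨e1, -⟩ := hS.dist_circleCenter_of_sorted hx
  have hrad : 0 < (tripleCircle (p, q, r)).radius := by
    refine lt_of_le_of_ne dist_nonneg fun e => npq ?_
    have e : dist p (circleCenter p q r) = 0 := e.symm
    rw [dist_eq_zero.1 e, ← dist_eq_zero.1 (e1.trans e)]
  rw [IsSplitting, hS.points_on_tripleCircle hx, hS.points_in_tripleCircle hx,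
    hS.points_out_tripleCircle hx, Set.ncard_coe_finset, Set.ncard_coe_finset,
    Set.ncard_coe_finset, card_eq_three.2 ⟨p, q, r, npq, npr, nqr, rfl⟩]
  simp [hrad]

theorem exists_tripleCircle_eq (hS : InGeneralPosition S) (ht : Set.InjOn (height t) S) {a b : ℕ}
    {C : EuclideanGeometry.Sphere Plane} (hC : IsSplitting S a b C) :
    ∃ x ∈ sortedTriples (height t) S, tripleCircle x = C := by
  obtain ⟨-, h3, -⟩ := hC
  have hset : {s | s ∈ S ∧ dist s C.center = C.radius} =
      (({s ∈ S | dist s C.center = C.radius} : Finset Plane) : Set Plane) := by simp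
  rw [hset, Set.ncard_coe_finset] at h3
  obtain ⟨p, q, r, e, h1, h2⟩ := exists_sorted_triple
    (ht.mono (by exact_mod_cast filter_subset _ _)) h3
  have hp : p ∈ ({s ∈ S | dist s C.center = C.radius} : Finset Plane) := e ▸ by simp
  have hq : q ∈ ({s ∈ S | dist s C.center = C.radius} : Finset Plane) := e ▸ by simp
  have hr : r ∈ ({s ∈ S | dist s C.center = C.radius} : Finset Plane) := e ▸ by simp
  rw [mem_filter] at hp hq hr
  have hx : (p, q, r) ∈ sortedTriples (height t) S :=
    mem_sortedTriples_height.2 ⟨⟨hp.1, hq.1, hr.1⟩, h1, h2⟩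
  obtain ⟨e1, e2⟩ := hS.dist_circleCenter_of_sorted hx
  obtain ⟨npq, npr, nqr⟩ := ne_of_sorted h1 h2
  have hcen : circleCenter p q r = C.center :=
    equidistant_unique (hS.signedArea_ne_zero hp.1 hq.1 hr.1 npq npr nqr) e1 e2
      (hq.2.trans hp.2.symm) (hr.2.trans hp.2.symm)
  exact ⟨_, hx, EuclideanGeometry.Sphere.ext hcen (by simp only [tripleCircle]; rw [hcen, hp.2])⟩

/-- The circle meets S in exactly its triple, and the heights fix the order. -/
theorem injOn_tripleCircle (hS : InGeneralPosition S) :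
    Set.InjOn tripleCircle (sortedTriples (height t) S) := by
  rintro ⟨p, q, r⟩ hx ⟨p', q', r'⟩ hx' e
  have h := hS.points_on_tripleCircle hx
  rw [e, hS.points_on_tripleCircle hx', coe_inj] at h
  obtain ⟨-, h1, h2⟩ := mem_sortedTriples_height.1 hx
  obtain ⟨-, h1', h2'⟩ := mem_sortedTriples_height.1 hx'
  exact sorted_triple_unique h.symm h1 h2 h1' h2'

/-- By general position no fourth point lies on the circle. -/
theorem card_related_add_card_related (hS : InGeneralPosition S) {x : Plane × Plane × Plane}
    (hx : x ∈ sortedTriples (height t) S) :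
    #(related InCircle S x) + #(related OutCircle S x) + 3 = #S := by
  obtain ⟨p, q, r⟩ := x
  obtain ⟨⟨hp, hq, hr⟩, h1, h2⟩ := mem_sortedTriples_height.1 hx
  obtain ⟨npq, npr, nqr⟩ := ne_of_sorted h1 h2
  obtain ⟨e1, e2⟩ := hS.dist_circleCenter_of_sorted hx
  have d1 : Disjoint (related InCircle S (p, q, r)) (related OutCircle S (p, q, r)) := by
    rw [disjoint_left]
    intro s hs hs'
    simp only [related, mem_filter] at hs hs'
    exact lt_asymm hs.2.2.2.2 hs'.2.2.2.2
  have d2 : Disjoint (related InCircle S (p, q, r) ∪ related OutCircle S (p, q, r)) {p, q, r} := by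
    rw [disjoint_left]
    intro s hs
    simp only [related, mem_union, mem_filter] at hs
    simp only [mem_insert, mem_singleton]
    tauto
  rw [← card_union_of_disjoint d1, ← card_eq_three.2 ⟨p, q, r, npq, npr, nqr, rfl⟩,
    ← card_union_of_disjoint d2]
  congr 1
  ext s
  simp only [related, mem_union, mem_filter, mem_insert, mem_singleton]
  constructor
  · rintro ((⟨h, -⟩ | ⟨h, -⟩) | rfl | rfl | rfl) <;> assumption
  · intro hs
    by_cases hsp : s = p
    · exact Or.inr (Or.inl hsp)
    by_cases hsq : s = q
    · exact Or.inr (Or.inr (Or.inl hsq))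
    by_cases hsr : s = r
    · exact Or.inr (Or.inr (Or.inr hsr))
    left
    rcases (hS.dist_ne hp hq hr hs npq npr nqr hsp hsq hsr e1 e2).lt_or_gt with h | h
    · exact Or.inl ⟨hs, hsp, hsq, hsr, h⟩
    · exact Or.inr ⟨hs, hsp, hsq, hsr, h⟩

end InGeneralPosition

end Counting

theorem theorem2 (n a b : ℕ) (S : Finset Plane) (hcard : S.card = 2 * n + 1)
    (hS : InGeneralPosition S) (hlt : a < b) (hab : a + b + 2 = 2 * n) :
    {C : EuclideanGeometry.Sphere Plane | IsSplitting S a b C ∨ IsSplitting S b a C}.Finite ∧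
    {C : EuclideanGeometry.Sphere Plane | IsSplitting S a b C ∨ IsSplitting S b a C}.ncard =
      2 * (a + 1) * (b + 1) := by
  classical
  obtain ⟨t, ht⟩ := exists_height_injOn S
  -- Inside and outside counts add up to a + b, so one of them being a forces the other to be b.
  have himage : {C : EuclideanGeometry.Sphere Plane | IsSplitting S a b C ∨ IsSplitting S b a C} =
      tripleCircle '' (({x ∈ sortedTriples (height t) S | (related InCircle S x).card = a ∨
        (related OutCircle S x).card = a} : Finset _) : Set (Plane × Plane × Plane)) := by
    ext C
    simp only [Set.mem_ofPred_eq, Finset.coe_filter, Set.mem_image]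
    constructor
    · intro hC
      obtain ⟨x, hx, rfl⟩ : ∃ x ∈ sortedTriples (height t) S, tripleCircle x = C :=
        hC.elim (hS.exists_tripleCircle_eq ht) (hS.exists_tripleCircle_eq ht)
      rw [hS.isSplitting_tripleCircle hx, hS.isSplitting_tripleCircle hx] at hC
      exact ⟨x, ⟨hx, by tauto⟩, rfl⟩
    · rintro ⟨x, ⟨hx, h⟩, rfl⟩
      rw [hS.isSplitting_tripleCircle hx, hS.isSplitting_tripleCircle hx]
      have := hS.card_related_add_card_related hx
      omega
  have hinj : Set.InjOn tripleCircle (({x ∈ sortedTriples (height t) S |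
      (related InCircle S x).card = a ∨ (related OutCircle S x).card = a} : Finset _) :
        Set (Plane × Plane × Plane)) :=
    (hS.injOn_tripleCircle (t := t)).mono (by exact_mod_cast Finset.filter_subset _ _)
  rw [himage]
  refine ⟨(Finset.finite_toSet _).image _, ?_⟩
  rw [hinj.ncard_image, Set.ncard_coe_finset, Finset.filter_or,
    Finset.card_union_of_disjoint]
  -- Here |S| = a + b + 3 = k + 2, so k - a = b + 1.
  · rw [card_filter_card_related (height t) InCircle ht
      (fun U hU p hp => hS.card_extremePairs ht hU hp) (k := a + b + 1) (by omega) (by omega)]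
    congr 1
    omega
  -- Both counts equal to a would give 2a = a + b, against a < b.
  · rw [Finset.disjoint_filter]
    intro x hx h1 h2
    have := hS.card_related_add_card_related hx
    omega
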